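/- **Setting.** A multi-player mean-payoff game arena consists of a finite set $P$ of players with a distinguished leader $l$ (the others are followers), a finite set $V$ of vertices with an initial vertex $v_0$, each vertex being owned by one player, edges $E\subseteq V\times V$ such that every vertex has a successor, and rewards $r_p:E\to\mathbb Q$ for $p\in P$. A history is a finite sequence of vertices; a finite play is a history that starts in $v_0$ and follows edges. A strategy of $p$ maps every history that ends in a vertex $v$ of $p$ to a successor of $v$; a strategy profile $\sigma=(\sigma_p)_{p\in P}$ defines an infinite play $\pi_\sigma=v_0v_1v_2\dots$. The raw payoff is $r_p(\pi)=\liminf_n \frac1n\sum_{i<n}r_p(v_i,v_{i+1})$. An incentive profile $\gamma$ assigns to every follower $p$ and every nonempty history $h$ a real $\gamma_p(h)\ge 0$; along $\pi$ it pays $\gamma_p(\pi)=\liminf_n\frac1n\sum_{i<n}\gamma_p(v_0\dots v_i)$. For $(\sigma,\gamma)$ the payoff of a follower $p$ is $r_p(\pi_\sigma)+\gamma_p(\pi_\sigma)$, and the leader's payoff is $r_l(\pi_\sigma)-\sum_{p\ne l}\gamma_p(\pi_\sigma)$. * $(\sigma,\gamma)$ is an *incentive strategy profile* (ISP) if no follower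 can increase his payoff by unilaterally changing his strategy. * A finite play is *deviating* if it is not a prefix of $\pi_\sigma$; its *deviator* is the owner of the last position on it at which the move differs from the one prescribed by $\sigma$. * For a player $p$, $\mathcal G_p$ is the two-player zero-sum mean-payoff game in which $p$ maximises $r_p(\pi)$ against the coalition of all other players. For each $p$, let $\tau_p:V\to V$ be memoryless strategies of both sides in $\mathcal G_p$ ($\tau_p(v)$ is the successor chosen by whichever side moves at $v$) that are optimal from every vertex. Let $r_{\max}$ be the largest reward of any player on any edge. * $(\sigma,\gamma)$ is a *perfectly-incentivised strategy profile* (PSP) if, for some such choice of $(\tau_p)_{p\in P}$: (i) for each follower $p$, $\gamma_p(h)$ is the same for all nonempty prefixes $h$ of $\pi_\sigma$; (ii) on every deviating history $h$ with deviator $p$ and last vertex $v$, $\sigma$ prescribes the move to $v'=\tau_p(v)$; if moreover the owner $p'$ of $v$ is a follower and $p'\neq p$, then $r_{p'}(v,v')+\gamma_{p'}(h\cdot v')=r_{\max}+1$; (iii) on deviating histories all incentives not prescribed by (ii) are $0$. * $\sigma$ is *well behaved* if, for every edge $e$, the share of $e$ among the first $n$ edges of $\pi_\sigma$ converges as $n\to\infty$.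 **Theorem.** PSPs that are also ISPs but are not well behaved cannot give the leader a larger payoff than well-behaved PSPs that are also ISPs: for every PSP $(\sigma,\gamma)$ that is an ISP there is a well-behaved PSP $(\sigma',\gamma')$ that is also an ISP and in which the leader's payoff is at least her payoff in $(\sigma,\gamma)$. -/

import Mathlib

open Filter Topology
open scoped NNReal

noncomputable section

/-- A multi-player mean-payoff game arena over the players `P` and the vertices `V`.
The partition of the vertices is given by the owner of each vertex. Only the values of `reward`
on edges are ever used. -/
structure Arena (P V : Type*) where
  leader : P
  init : V
  owner : V → P
  Edge : V → V → Prop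
  total : ∀ v, ∃ w, Edge v w
  reward : P → V → V → ℚ

/-- The limit average `liminf (1/n) ∑_{i<n} x i`, in the extended reals (so that it is the true
lower limit for unbounded sequences, too). -/
def meanPayoff (x : ℕ → ℝ) : EReal :=
  liminf (fun n : ℕ => (((∑ i ∈ Finset.range n, x i) / (n : ℝ) : ℝ) : EReal)) atTop

/-- The vertices `π (n-1), …, π 0` seen strictly before time `n`, most recent vertex first.
Throughout, a nonempty history `v₀ … vₙ` is represented by the pair of its past
`[vₙ₋₁, …, v₀]` and its last vertex `vₙ`. -/
def past {V : Type*} (π : ℕ → V) : ℕ → List V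
  | 0 => []
  | n + 1 => π n :: past π n

namespace Arena

variable {P V : Type*} (G : Arena P V)

/-- The followers: all players but the leader. -/
def Follower : Type _ := {p : P // p ≠ G.leader}

open Classical in
instance [Fintype P] : Fintype G.Follower :=
  inferInstanceAs (Fintype {p : P // p ≠ G.leader})

/-- A strategy of `p`: a map from histories (past, last vertex) whose last vertex is owned by `p`
to a successor of that last vertex. -/
def Strategy (p : P) : Type _ :=
  List V → (v : {v : V // G.owner v = p}) → {w : V // G.Edge v w}

/-- A strategy profile. -/
def Profile : Type _ := (p : P) → G.Strategy p

/-- An incentive profile: for each follower, a map from histories (past, last vertex) to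
nonnegative reals. -/
def IncentiveProfile : Type _ := G.Follower → List V → V → ℝ≥0

/-- The raw payoff of player `p` for an infinite sequence of vertices. -/
def rawPayoff (p : P) (π : ℕ → V) : EReal :=
  meanPayoff fun i => (G.reward p (π i) (π (i + 1)) : ℝ)

variable {G}

/-- The successor chosen under `σ` at the history with past `h` and last vertex `v`. -/
def Profile.move (σ : G.Profile) (h : List V) (v : V) : V :=
  (σ (G.owner v) h ⟨v, rfl⟩ : {w : V // G.Edge v w})

/-- The history of length `n + 1` produced by `σ`, as (past, last vertex). -/
def Profile.historyAt (σ : G.Profile) : ℕ → List V × V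
  | 0 => ([], G.init)
  | n + 1 =>
    ((σ.historyAt n).2 :: (σ.historyAt n).1, σ.move (σ.historyAt n).1 (σ.historyAt n).2)

/-- The unique infinite play defined by `σ`. -/
def Profile.play (σ : G.Profile) (n : ℕ) : V := (σ.historyAt n).2

theorem Profile.historyAt_fst (σ : G.Profile) (n : ℕ) :
    (σ.historyAt n).1 = past σ.play n := by
  induction n with
  | zero => rfl
  | succ n ih => simp [Profile.historyAt, past, ih, Profile.play]

theorem Profile.play_succ (σ : G.Profile) (n : ℕ) :
    σ.play (n + 1) = σ.move (past σ.play n) (σ.play n) := by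
  rw [← σ.historyAt_fst n]
  rfl

/-- The incentive paid to follower `p` along an infinite sequence of vertices. -/
def IncentiveProfile.payoff (γ : G.IncentiveProfile) (p : G.Follower) (π : ℕ → V) : EReal :=
  meanPayoff fun i => (γ p (past π i) (π i) : ℝ)

/-- The overall payoff of follower `p`: raw payoff plus incentive. -/
def followerPayoff (σ : G.Profile) (γ : G.IncentiveProfile) (p : G.Follower) : EReal :=
  G.rawPayoff p.1 σ.play + γ.payoff p σ.play

/-- The overall payoff of the leader: raw payoff minus all incentives. -/
def leaderPayoff [Fintype P] (σ : G.Profile) (γ : G.IncentiveProfile) : EReal :=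
  G.rawPayoff G.leader σ.play - ∑ p : G.Follower, γ.payoff p σ.play

open Classical in
/-- The profile in which player `p` deviates from `σ` to the strategy `s`. -/
def Profile.deviate (σ : G.Profile) (p : P) (s : G.Strategy p) : G.Profile :=
  Function.update σ p s

/-- Incentive strategy profile (ISP): no follower can improve the overall payoff by a unilateral
deviation. -/
def IsISP (σ : G.Profile) (γ : G.IncentiveProfile) : Prop :=
  ∀ (p : G.Follower) (s : G.Strategy p.1),
    followerPayoff (σ.deviate p.1 s) γ p ≤ followerPayoff σ γ p

open Classical in
/-- The fraction of the first `n` steps of `π` that take the edge `(u, v)`. -/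
def edgeFreq (π : ℕ → V) (u v : V) (n : ℕ) : ℝ :=
  (((Finset.range n).filter fun i => π i = u ∧ π (i + 1) = v).card : ℝ) / (n : ℝ)

/-- Well-behaved profile: on its play, the frequency of every edge has a limit. -/
def IsWellBehaved (σ : G.Profile) : Prop :=
  ∀ u v : V, G.Edge u v → ∃ x : ℝ, Tendsto (edgeFreq σ.play u v) atTop (𝓝 x)

/-! ### The two-player zero-sum games `G_p` -/

variable (G)

/-- `π` is an infinite path of the arena from `v`. -/
def IsPathFrom (v : V) (π : ℕ → V) : Prop :=
  π 0 = v ∧ ∀ i, G.Edge (π i) (π (i + 1))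

/-- The value of the vertex `v` in the two-player mean-payoff game in which `p` maximises the raw
payoff of `p` against the coalition of all other players: the best payoff that `p` can guarantee
with a (history-dependent) strategy against all paths consistent with it. -/
def gameValue (p : P) (v : V) : EReal :=
  ⨆ s : G.Strategy p,
    ⨅ π : {π : ℕ → V // G.IsPathFrom v π ∧
      ∀ (i : ℕ) (hi : G.owner (π i) = p), π (i + 1) = (s (past π i) ⟨π i, hi⟩).1},
    G.rawPayoff p π.1

/-- `τ` consists of memoryless strategies of both sides, of `p` (at the vertices of `p`) and of the
coalition of the other players (at the other vertices), that are optimal from every vertex in the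
two-player mean-payoff game of `p` against the coalition. -/
structure IsOptimalMemoryless (p : P) (τ : V → V) : Prop where
  edge : ∀ v, G.Edge v (τ v)
  maximiser : ∀ (v : V) (π : ℕ → V), G.IsPathFrom v π →
    (∀ i, G.owner (π i) = p → π (i + 1) = τ (π i)) → G.gameValue p v ≤ G.rawPayoff p π
  minimiser : ∀ (v : V) (π : ℕ → V), G.IsPathFrom v π →
    (∀ i, G.owner (π i) ≠ p → π (i + 1) = τ (π i)) → G.rawPayoff p π ≤ G.gameValue p v

/-- The largest reward of any player on any edge. -/
def rMax : ℝ :=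
  sSup {x : ℝ | ∃ (p : P) (u v : V), G.Edge u v ∧ x = (G.reward p u v : ℝ)}

/-- The finite plays from the initial vertex, as (past, last vertex). -/
inductive IsFinitePlay : List V → V → Prop
  | init : IsFinitePlay [] G.init
  | step {h : List V} {v w : V} : IsFinitePlay h v → G.Edge v w → IsFinitePlay (v :: h) w

variable {G}

/-! ### Perfectly-incentivised strategy profiles -/

/-- The history with past `h` and last vertex `v` is a prefix of the play of `σ`. -/
def IsPrefix (σ : G.Profile) (h : List V) (v : V) : Prop :=
  ∃ n, h = past σ.play n ∧ v = σ.play n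

/-- Deviating histories: finite plays that are not a prefix of the play of `σ`. -/
def IsDeviating (σ : G.Profile) (h : List V) (v : V) : Prop :=
  G.IsFinitePlay h v ∧ ¬ IsPrefix σ h v

open Classical in
/-- The last player who deviated from `σ` on the history with past `h` and last vertex `v`
(`none` if nobody did). -/
def dev (σ : G.Profile) : List V → V → Option P
  | [], _ => none
  | u :: h, v => if v = σ.move h u then dev σ h u else some (G.owner u)

/-- The deviating histories are exactly those finite plays on which somebody deviated. -/
theorem isDeviating_iff (σ : G.Profile) {h : List V} {v : V} (hv : G.IsFinitePlay h v) :
    IsDeviating σ h v ↔ ∃ p, dev σ h v = some p := by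
  have key : IsPrefix σ h v ↔ dev σ h v = none := by
    induction hv with
    | init => exact ⟨fun _ => rfl, fun _ => ⟨0, rfl, rfl⟩⟩
    | @step h v w hv hw ih =>
      simp only [dev]
      constructor
      · rintro ⟨n, h1, h2⟩
        cases n with
        | zero => simp [past] at h1
        | succ n =>
          simp only [past, List.cons.injEq] at h1
          rw [σ.play_succ, ← h1.1, ← h1.2] at h2
          rw [if_pos h2]
          exact ih.1 ⟨n, h1.2, h1.1⟩
      · intro hd
        by_cases hc : w = σ.move h v
        · rw [if_pos hc] at hd
          obtain ⟨n, h1, h2⟩ := ih.2 hd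
          refine ⟨n + 1, ?_, ?_⟩
          · simp [past, h1, h2]
          · rw [σ.play_succ, ← h1, ← h2, hc]
        · rw [if_neg hc] at hd
          cases hd
  rw [IsDeviating, key, ← Option.ne_none_iff_exists']
  exact ⟨fun h => h.2, fun h => ⟨hv, h⟩⟩

/-- Follower `q` has just colluded against a deviator: the history with past `h` and last vertex
`v` extends a deviating history, with a deviator other than `q` and a last vertex owned by `q`, by
the move to `v` that `q` is to make there. -/
def HasColluded (σ : G.Profile) (q : G.Follower) (h : List V) (v : V) : Prop :=
  ∃ (g : List V) (u : V) (p : P), h = u :: g ∧ IsDeviating σ g u ∧ dev σ g u = some p ∧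
    G.owner u = q.1 ∧ q.1 ≠ p ∧ v = σ.move g u

/-- Perfectly-incentivised strategy profile (PSP), for a choice `τ p` of memoryless optimal
strategies in the two-player mean-payoff game of each player `p` against all others. -/
structure IsPSPFor (τ : P → V → V) (σ : G.Profile) (γ : G.IncentiveProfile) : Prop where
  optimal : ∀ p, G.IsOptimalMemoryless p (τ p)
  /-- Along the play, the incentive of each follower is constant. -/
  const : ∀ (p : G.Follower) (h h' : List V) (v v' : V),
    IsPrefix σ h v → IsPrefix σ h' v' → γ p h v = γ p h' v'
  /-- On deviating histories, everybody follows the strategy from the game of the last deviator. -/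
  punish : ∀ (h : List V) (v : V) (p : P),
    IsDeviating σ h v → dev σ h v = some p → σ.move h v = τ p v
  /-- A follower who colludes against a deviator is paid up to `rMax + 1`. -/
  collude : ∀ (q : G.Follower) (h : List V) (u v : V),
    HasColluded σ q (u :: h) v → (G.reward q.1 u v : ℝ) + (γ q (u :: h) v : ℝ) = G.rMax + 1
  /-- On deviating histories, all other incentives are `0`. -/
  zero : ∀ (q : G.Follower) (h : List V) (v : V),
    IsDeviating σ h v → ¬ HasColluded σ q h v → γ q h v = 0

/-- Perfectly-incentivised strategy profile (PSP). -/
def IsPSP (σ : G.Profile) (γ : G.IncentiveProfile) : Prop :=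
  ∃ τ : P → V → V, IsPSPFor τ σ γ

end Arena

end

/-! A PSP is an ISP exactly when every follower's overall payoff is at least the value, in his own
zero-sum game, of every vertex on the play. Necessity (`IsISP.gameValue_le`): a follower may obey
until such a vertex and play his optimal strategy from there, and incentives only add to this.
Sufficiency (`IsPSPFor.isISP`): a deviator is punished optimally and receives no incentive
afterwards.

It therefore suffices to find a play through vertices of the old play on which edge frequencies
converge and no raw payoff drops; the constant incentives are kept. Some vertex `w` recurs
infinitely often, and by compactness all edge frequencies and average rewards converge along a
subsequence of its visits. Each such limit is at least the corresponding lower limit. The new play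
repeats the segments of the old one from a fixed visit of `w` to ever later visits of that
subsequence, lengthening them so slowly that the unfinished segment is negligible
(`tendsto_average_loopState`). Its averages converge to the subsequence limits
(`exists_reordering_averages_tendsto`), and `profileOfPlay` with `perfectIncentives` makes a PSP of
it. -/

/-! ### Limit averages -/

theorem liminf_coe_le_of_tendsto_sub {u v : ℕ → ℝ}
    (h : Tendsto (fun n => v n - u n) atTop (𝓝 0)) :
    liminf (fun n => (u n : EReal)) atTop ≤ liminf (fun n => (v n : EReal)) atTop := by
  have h0 : liminf (fun n => ((v n - u n : ℝ) : EReal)) atTop = 0 :=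
    ((continuous_coe_real_ereal.tendsto 0).comp h).liminf_eq
  have := EReal.le_liminf_add (f := atTop) (u := fun n => (u n : EReal))
    (v := fun n => ((v n - u n : ℝ) : EReal))
  rw [h0, add_zero] at this
  refine this.trans_eq ?_
  congr 1
  ext n
  simp only [Pi.add_apply]
  rw [← EReal.coe_add]
  congr 1
  ring

theorem meanPayoff_le_of_sum_sub_le {x y : ℕ → ℝ} {C : ℝ}
    (h : ∀ n, |∑ i ∈ Finset.range n, y i - ∑ i ∈ Finset.range n, x i| ≤ C) :
    meanPayoff x ≤ meanPayoff y := by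
  refine liminf_coe_le_of_tendsto_sub ?_
  refine squeeze_zero_norm (a := fun n : ℕ => C / n) (fun n => ?_)
    (tendsto_const_div_atTop_nhds_zero_nat C)
  rw [← sub_div, norm_div, Real.norm_natCast, Real.norm_eq_abs]
  exact div_le_div_of_nonneg_right (h n) n.cast_nonneg

/-- The two partial sums differ only by `k` terms at either end, a bounded amount that vanishes
after division by `n`. -/
theorem meanPayoff_shift {x : ℕ → ℝ} {B : ℝ} (hx : ∀ i, |x i| ≤ B) (k : ℕ) :
    meanPayoff (fun i => x (k + i)) = meanPayoff x := by
  have key (n : ℕ) : ∑ i ∈ Finset.range n, x (k + i) - ∑ i ∈ Finset.range n, x i =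
      ∑ i ∈ Finset.range k, x (n + i) - ∑ i ∈ Finset.range k, x i := by
    have h1 := Finset.sum_range_add x k n
    have h2 := Finset.sum_range_add x n k
    rw [add_comm n k] at h2
    linarith
  have hb (n : ℕ) : |∑ i ∈ Finset.range n, x (k + i) - ∑ i ∈ Finset.range n, x i| ≤
      k * B + k * B := by
    rw [key]
    have hs (y : ℕ → ℝ) (hy : ∀ i, |y i| ≤ B) : |∑ i ∈ Finset.range k, y i| ≤ k * B := by
      refine (Finset.abs_sum_le_sum_abs _ _).trans ?_
      refine (Finset.sum_le_sum fun i _ => hy i).trans_eq ?_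
      simp
    exact (abs_sub _ _).trans (add_le_add (hs _ fun i => hx _) (hs _ hx))
  refine le_antisymm (meanPayoff_le_of_sum_sub_le (C := k * B + k * B) fun n => ?_)
    (meanPayoff_le_of_sum_sub_le (C := k * B + k * B) hb)
  rw [abs_sub_comm]
  exact hb n

theorem meanPayoff_nonneg {x : ℕ → ℝ} (hx : ∀ i, 0 ≤ x i) : 0 ≤ meanPayoff x := by
  refine le_liminf_of_le (by isBoundedDefault) (Eventually.of_forall fun n => ?_)
  exact_mod_cast div_nonneg (Finset.sum_nonneg fun i _ => hx i) n.cast_nonneg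

theorem meanPayoff_le_zero {x : ℕ → ℝ} {n : ℕ} (hx : ∀ i, n ≤ i → x i = 0) :
    meanPayoff x ≤ 0 := by
  have h0 : meanPayoff (fun _ => 0) = 0 := by simp [meanPayoff]
  rw [← h0]
  refine meanPayoff_le_of_sum_sub_le (C := ∑ i ∈ Finset.range n, |x i|) fun m => ?_
  simp only [Finset.sum_const_zero, zero_sub, abs_neg]
  refine (Finset.abs_sum_le_sum_abs _ _).trans ?_
  obtain h | h := le_total m n
  · exact Finset.sum_le_sum_of_subset_of_nonneg (Finset.range_mono h) fun _ _ _ => abs_nonneg _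
  · refine (Finset.sum_subset (Finset.range_mono h) fun i _ hi => ?_).ge
    rw [hx i (by simpa using hi), abs_zero]

theorem meanPayoff_eq_of_tendsto {x : ℕ → ℝ} {c : ℝ}
    (h : Tendsto (fun n : ℕ => (∑ i ∈ Finset.range n, x i) / (n : ℝ)) atTop (𝓝 c)) :
    meanPayoff x = c :=
  ((continuous_coe_real_ereal.tendsto c).comp h).liminf_eq

theorem meanPayoff_le_of_tendsto_subseq {x : ℕ → ℝ} {c : ℝ} {N : ℕ → ℕ}
    (hN : Tendsto N atTop atTop)
    (h : Tendsto (fun k => (∑ i ∈ Finset.range (N k), x i) / (N k : ℝ)) atTop (𝓝 c)) :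
    meanPayoff x ≤ c := by
  rw [← ((continuous_coe_real_ereal.tendsto c).comp h).liminf_eq]
  exact liminf_le_liminf_of_le (f := atTop) (g := map N atTop) hN

/-- Every sequence of thresholds can be reparametrised so as to grow slowly. -/
theorem exists_tendsto_sq_le (L : ℕ → ℕ) :
    ∃ k : ℕ → ℕ, Tendsto k atTop atTop ∧ ∀ᶠ j in atTop, L (k j) ^ 2 ≤ j := by
  -- The largest index up to `j` whose squared threshold is at most `j`; once `L 0 ^ 2 ≤ j`, index
  -- `0` qualifies, so the search does not fall back on its default.
  refine ⟨fun j => Nat.findGreatest (fun k => L k ^ 2 ≤ j) j, ?_, ?_⟩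
  · refine tendsto_atTop.2 fun K => ?_
    filter_upwards [eventually_ge_atTop K, eventually_ge_atTop (L K ^ 2)] with j h1 h2
    exact Nat.le_findGreatest h1 h2
  · filter_upwards [eventually_ge_atTop (L 0 ^ 2)] with j h
    exact Nat.findGreatest_spec (P := fun k => L k ^ 2 ≤ j) (Nat.zero_le j) h

/-! ### Repeating segments of a sequence -/

/-- A pointer that moves forwards through the natural numbers and, for the `j`-th time, jumps back
to `a` instead of reaching `N j`; with the number of jumps made so far. -/
def loopState (a : ℕ) (N : ℕ → ℕ) : ℕ → ℕ × ℕ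
  | 0 => (0, 0)
  | n + 1 =>
    if (loopState a N n).1 + 1 = N (loopState a N n).2 then (a, (loopState a N n).2 + 1)
    else ((loopState a N n).1 + 1, (loopState a N n).2)

section Loop

variable {a : ℕ} {N : ℕ → ℕ}

theorem loopState_fst_lt (ha : ∀ j, a < N j) (n : ℕ) :
    (loopState a N n).1 < N (loopState a N n).2 := by
  induction n with
  | zero => exact (Nat.zero_le a).trans_lt (ha 0)
  | succ n ih =>
    rw [loopState]
    split_ifs with h
    · exact ha _
    · exact lt_of_le_of_ne ih h

theorem loopState_snd_le (n : ℕ) : (loopState a N n).2 ≤ n := by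
  induction n with
  | zero => exact le_rfl
  | succ n ih =>
    rw [loopState]
    split_ifs <;> simp only <;> omega

/-- Each jump from `N i` to `a` replaces the prefix sum at `N i` by the one at `a`; the second sum
collects these differences. The initial stretch below `a` stays in the first term. -/
theorem sum_loopState (e : ℕ → ℝ) (n : ℕ) :
    ∑ i ∈ Finset.range n, e (loopState a N i).1 =
      ∑ i ∈ Finset.range (loopState a N n).1, e i +
        ∑ i ∈ Finset.range (loopState a N n).2,
          (∑ m ∈ Finset.range (N i), e m - ∑ m ∈ Finset.range a, e m) := by
  induction n with
  | zero => simp [loopState]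
  | succ n ih =>
    rw [Finset.sum_range_succ, ih, loopState]
    split_ifs with h
    · simp only [Finset.sum_range_succ, ← h]
      ring
    · simp only [Finset.sum_range_succ]
      ring

theorem sum_loopState_length (n : ℕ) :
    (n : ℝ) = (loopState a N n).1 +
      ∑ i ∈ Finset.range (loopState a N n).2, ((N i : ℝ) - a) := by
  simpa using sum_loopState (a := a) (N := N) (fun _ => 1) n

theorem tendsto_loopState_snd (ha : ∀ j, a < N j) :
    Tendsto (fun n => (loopState a N n).2) atTop atTop := by
  have hmono : Monotone fun n => (loopState a N n).2 := by
    refine monotone_nat_of_le_succ fun n => ?_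
    rw [loopState]
    split_ifs <;> simp
  refine tendsto_atTop_atTop_of_monotone hmono fun J => ?_
  -- If fewer than `J` jumps were ever made, the length formula would bound the elapsed time `n`.
  by_contra! hJ
  obtain ⟨n, hn⟩ := exists_nat_gt (∑ j ∈ Finset.range J, (N j : ℝ) +
    ∑ i ∈ Finset.range J, ((N i : ℝ) - a))
  have hpos (i : ℕ) : 0 ≤ (N i : ℝ) - a := sub_nonneg.2 (by exact_mod_cast (ha i).le)
  have h1 : ((loopState a N n).1 : ℝ) ≤ ∑ j ∈ Finset.range J, (N j : ℝ) :=
    (Nat.cast_le.2 (loopState_fst_lt ha n).le).trans <|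
      Finset.single_le_sum (f := fun j => (N j : ℝ)) (fun i _ => (N i).cast_nonneg)
        (Finset.mem_range.2 (hJ n))
  have h2 : ∑ i ∈ Finset.range (loopState a N n).2, ((N i : ℝ) - a) ≤
      ∑ i ∈ Finset.range J, ((N i : ℝ) - a) :=
    Finset.sum_le_sum_of_subset_of_nonneg (Finset.range_mono (hJ n).le) fun i _ _ => hpos i
  linarith [sum_loopState_length (a := a) (N := N) n]

-- After centring at `c`, a finished loop contributes little-o of its length, and the finished loops
-- have total length at most `n`. The unfinished one contributes `O(N j)`, which is `o(j)` by slow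
-- growth, and the number `j` of jumps is at most `n`.
open Asymptotics in
theorem tendsto_average_loopState (ha : ∀ j, a < N j) (hN : Tendsto N atTop atTop)
    (hslow : (fun j => (N j : ℝ)) =o[atTop] fun j => (j : ℝ)) {e : ℕ → ℝ} {B c : ℝ}
    (he : ∀ i, |e i| ≤ B)
    (hc : Tendsto (fun j => (∑ i ∈ Finset.range (N j), e i) / (N j : ℝ)) atTop (𝓝 c)) :
    Tendsto (fun n : ℕ => (∑ i ∈ Finset.range n, e (loopState a N i).1) / (n : ℝ))
      atTop (𝓝 c) := by
  set S : ℕ → ℝ := fun m => ∑ i ∈ Finset.range m, (e i - c) with hS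
  have hSeq (m : ℕ) : S m = ∑ i ∈ Finset.range m, e i - m * c := by
    simp [hS, Finset.sum_sub_distrib]
  have hNpos (j : ℕ) : (0 : ℝ) < N j := by exact_mod_cast (Nat.zero_le a).trans_lt (ha j)
  have hlen (j : ℕ) : (1 : ℝ) ≤ (N j : ℝ) - a := by
    have : ((a + 1 : ℕ) : ℝ) ≤ N j := Nat.cast_le.2 (ha j)
    push_cast at this
    linarith
  have hSN : (fun j => S (N j)) =o[atTop] fun j => (N j : ℝ) := by
    refine isLittleO_of_tendsto' (Eventually.of_forall fun j h => absurd h (hNpos j).ne') ?_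
    have := hc.sub_const c
    rw [sub_self] at this
    refine this.congr fun j => ?_
    rw [hSeq, sub_div, mul_div_cancel_left₀ _ (hNpos j).ne']
  have hconst : (fun _ : ℕ => S a) =o[atTop] fun j => (N j : ℝ) :=
    isLittleO_const_left.2 <| Or.inr <|
      tendsto_norm_atTop_atTop.comp (tendsto_natCast_atTop_atTop.comp hN)
  -- The constant `a + 1` works because `(a + 1) * (N j - a) - N j = a * (N j - a - 1)`, which is
  -- nonnegative.
  have hNlen : (fun j => (N j : ℝ)) =O[atTop] fun j => (N j : ℝ) - a := by
    refine IsBigO.of_bound (a + 1) (Eventually.of_forall fun j => ?_)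
    rw [Real.norm_natCast, Real.norm_of_nonneg (zero_le_one.trans (hlen j))]
    nlinarith [hlen j, (a.cast_nonneg : (0 : ℝ) ≤ a)]
  have hsum := ((hSN.sub hconst).trans_isBigO hNlen).sum_range
    (fun j => zero_le_one.trans (hlen j)) (by
      refine tendsto_atTop_mono (fun n => ?_) tendsto_natCast_atTop_atTop
      calc (n : ℝ) = ∑ i ∈ Finset.range n, (1 : ℝ) := by simp
        _ ≤ _ := Finset.sum_le_sum fun i _ => hlen i)
  have hj := tendsto_loopState_snd ha
  have h1 : (fun n => ∑ i ∈ Finset.range (loopState a N n).2, (S (N i) - S a))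
      =o[atTop] fun n => (n : ℝ) := by
    refine (hsum.comp_tendsto hj).trans_isBigO (IsBigO.of_bound 1 (Eventually.of_forall fun n => ?_))
    simp only [Function.comp_apply]
    rw [Real.norm_natCast, Real.norm_of_nonneg
      (Finset.sum_nonneg fun i _ => zero_le_one.trans (hlen i)), one_mul]
    have := sum_loopState_length (a := a) (N := N) n
    linarith [((loopState a N n).1.cast_nonneg : (0 : ℝ) ≤ _)]
  have h2 : (fun n => S (loopState a N n).1) =o[atTop] fun n => (n : ℝ) := by
    have hb : (fun n => S (loopState a N n).1) =O[atTop]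
        fun n => (N (loopState a N n).2 : ℝ) := by
      refine IsBigO.of_bound (B + |c|) (Eventually.of_forall fun n => ?_)
      rw [Real.norm_natCast, Real.norm_eq_abs]
      have h3 : |S (loopState a N n).1| ≤ (loopState a N n).1 * (B + |c|) := by
        refine (Finset.abs_sum_le_sum_abs _ _).trans ?_
        refine (Finset.sum_le_sum fun i _ =>
          (abs_sub _ _).trans (add_le_add_left (he i) _)).trans_eq ?_
        rw [Finset.sum_const, Finset.card_range, nsmul_eq_mul]
      have hB : 0 ≤ B + |c| := add_nonneg ((abs_nonneg _).trans (he 0)) (abs_nonneg c)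
      rw [mul_comm]
      exact h3.trans (mul_le_mul_of_nonneg_right
        (Nat.cast_le.2 (loopState_fst_lt ha n).le) hB)
    refine hb.trans_isLittleO ((hslow.comp_tendsto hj).trans_isBigO ?_)
    refine IsBigO.of_bound 1 (Eventually.of_forall fun n => ?_)
    simp only [Function.comp_apply]
    rw [Real.norm_natCast, Real.norm_natCast, one_mul]
    exact Nat.cast_le.2 (loopState_snd_le n)
  have h3 := (h2.add h1).tendsto_div_nhds_zero.add_const c
  rw [zero_add] at h3
  refine h3.congr' ?_
  filter_upwards [eventually_gt_atTop 0] with n hn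
  have hn' : (n : ℝ) ≠ 0 := by exact_mod_cast hn.ne'
  have h4 := sum_loopState (a := a) (N := N) (fun i => e i - c) n
  change _ = S (loopState a N n).1 + ∑ i ∈ Finset.range (loopState a N n).2, (S (N i) - S a) at h4
  rw [← h4, Finset.sum_sub_distrib]
  simp only [Finset.sum_const, Finset.card_range, nsmul_eq_mul]
  field_simp
  ring

end Loop

/-- Every sequence over a finite set can be rearranged, by following its transitions in another
order, so that the averages of countably many functions of the transitions converge to limits of
averages of the given sequence. -/
theorem exists_reordering_averages_tendsto {V ι : Type*} [Finite V] [Countable ι] (π : ℕ → V)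
    (φ : ι → V → V → ℝ) :
    ∃ t : ℕ → ℕ, t 0 = 0 ∧ (∀ n, π (t (n + 1)) = π (t n + 1)) ∧ ∀ i, ∃ c : ℝ,
      meanPayoff (fun n => φ i (π n) (π (n + 1))) ≤ c ∧
      Tendsto (fun n : ℕ => (∑ m ∈ Finset.range n, φ i (π (t m)) (π (t (m + 1)))) / (n : ℝ))
        atTop (𝓝 c) := by
  have hB (i : ι) : ∃ B, ∀ u v, |φ i u v| ≤ B := by
    obtain ⟨B, hB⟩ := (Set.finite_range fun x : V × V => |φ i x.1 x.2|).bddAbove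
    exact ⟨B, fun u v => hB ⟨(u, v), rfl⟩⟩
  choose B hB using hB
  obtain ⟨w, hw⟩ := Finite.exists_infinite_fiber π
  have hw' : ∃ᶠ n in atTop, π n = w :=
    Nat.frequently_atTop_iff_infinite.2 (Set.infinite_coe_iff.1 hw)
  obtain ⟨f, hf, hfw⟩ := extraction_of_frequently_atTop hw'
  set avg : ℕ → ι → ℝ := fun n i => (∑ m ∈ Finset.range n, φ i (π m) (π (m + 1))) / (n : ℝ)
  have havg (n : ℕ) : avg n ∈ Set.univ.pi fun i => Set.Icc (-(B i)) (B i) := by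
    intro i _
    rw [Set.mem_Icc, ← abs_le, abs_div, Nat.abs_cast]
    have hBi : 0 ≤ B i := (abs_nonneg _).trans (hB i (π 0) (π 0))
    refine div_le_of_le_mul₀ n.cast_nonneg hBi ?_
    refine (Finset.abs_sum_le_sum_abs _ _).trans ?_
    refine (Finset.sum_le_sum fun m _ => hB i _ _).trans_eq ?_
    simp [mul_comm]
  -- One subsequence of the visits to `w` serves all indices at once; countability of `ι` makes the
  -- product first countable.
  obtain ⟨c, -, g, hg, hc⟩ := (isCompact_univ_pi fun i => isCompact_Icc).tendsto_subseq
    fun n => havg (f n)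
  rw [tendsto_pi_nhds] at hc
  obtain ⟨k, hk, hkL⟩ := exists_tendsto_sq_le fun j => f (g (j + 1))
  -- The shift by one keeps every loop end strictly after the loop start `f (g 0)`.
  set N : ℕ → ℕ := fun j => f (g (k j + 1))
  have ha (j : ℕ) : f (g 0) < N j := hf (hg (Nat.succ_pos _))
  have hk' : Tendsto (fun j => k j + 1) atTop atTop := (tendsto_add_atTop_nat 1).comp hk
  have hN : Tendsto N atTop atTop := (hf.tendsto_atTop.comp hg.tendsto_atTop).comp hk'
  have hNpos (j : ℕ) : (0 : ℝ) < N j := by exact_mod_cast (Nat.zero_le _).trans_lt (ha j)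
  have hslow : (fun j => (N j : ℝ)) =o[atTop] fun j => (j : ℝ) := by
    refine Asymptotics.isLittleO_of_tendsto' ?_ ?_
    · filter_upwards [eventually_gt_atTop 0] with j hj h
      exact absurd h (by exact_mod_cast hj.ne')
    · refine squeeze_zero' (g := fun j => ((N j : ℝ))⁻¹)
        (Eventually.of_forall fun j => by positivity) ?_
        (tendsto_inv_atTop_zero.comp (tendsto_natCast_atTop_atTop.comp hN))
      filter_upwards [hkL, eventually_gt_atTop 0] with j hj hj0
      have hj' : ((N j : ℝ)) ^ 2 ≤ j := by exact_mod_cast hj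
      have := hNpos j
      rw [div_le_iff₀ (by exact_mod_cast hj0), inv_mul_eq_div, le_div_iff₀ this, ← sq]
      exact hj'
  -- A jump goes from one visit of `w` to another, so it still follows a transition of `π`.
  have hstep (n : ℕ) : π (loopState (f (g 0)) N (n + 1)).1 =
      π ((loopState (f (g 0)) N n).1 + 1) := by
    rw [loopState]
    split_ifs with h
    · rw [h]
      exact (hfw _).trans (hfw _).symm
    · rfl
  refine ⟨fun n => (loopState (f (g 0)) N n).1, rfl, hstep, fun i => ⟨c i, ?_, ?_⟩⟩
  · exact meanPayoff_le_of_tendsto_subseq (hf.tendsto_atTop.comp hg.tendsto_atTop) (hc i)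
  · simp only [hstep]
    exact tendsto_average_loopState (e := fun m => φ i (π m) (π (m + 1))) ha hN hslow
      (fun m => hB i _ _) ((hc i).comp hk')

noncomputable section

namespace Arena

variable {P V : Type*} {G : Arena P V}

/-! ### Rewards, histories and unilateral deviations -/

theorem exists_abs_reward_le [Finite V] (G : Arena P V) (p : P) :
    ∃ B : ℝ, ∀ u v, |(G.reward p u v : ℝ)| ≤ B := by
  obtain ⟨B, hB⟩ := (Set.finite_range fun x : V × V => |(G.reward p x.1 x.2 : ℝ)|).bddAbove
  exact ⟨B, fun u v => hB ⟨(u, v), rfl⟩⟩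

theorem rawPayoff_shift [Finite V] (p : P) (π : ℕ → V) (n : ℕ) :
    G.rawPayoff p (fun i => π (n + i)) = G.rawPayoff p π := by
  obtain ⟨B, hB⟩ := G.exists_abs_reward_le p
  exact meanPayoff_shift (x := fun i => (G.reward p (π i) (π (i + 1)) : ℝ)) (fun i => hB _ _) n

theorem reward_le_rMax [Finite P] [Finite V] (p : P) {u v : V} (h : G.Edge u v) :
    (G.reward p u v : ℝ) ≤ G.rMax := by
  refine le_csSup (Set.Finite.bddAbove ?_) ⟨p, u, v, h, rfl⟩
  refine (Set.finite_range fun x : P × V × V => (G.reward x.1 x.2.1 x.2.2 : ℝ)).subset ?_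
  rintro _ ⟨p, u, v, -, rfl⟩
  exact ⟨(p, u, v), rfl⟩

theorem length_past (π : ℕ → V) (n : ℕ) : (past π n).length = n := by
  induction n with
  | zero => rfl
  | succ n ih => simp [past, ih]

theorem past_congr {π ρ : ℕ → V} {n : ℕ} (h : ∀ i < n, π i = ρ i) : past π n = past ρ n := by
  induction n with
  | zero => rfl
  | succ n ih => rw [past, past, h n n.lt_succ_self, ih fun i hi => h i (hi.trans n.lt_succ_self)]

namespace Profile

variable (σ : G.Profile)

theorem edge_move (h : List V) (v : V) : G.Edge v (σ.move h v) :=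
  (σ (G.owner v) h ⟨v, rfl⟩).2

theorem edge_play (n : ℕ) : G.Edge (σ.play n) (σ.play (n + 1)) := by
  rw [σ.play_succ]
  exact σ.edge_move _ _

theorem isFinitePlay_play (n : ℕ) : G.IsFinitePlay (past σ.play n) (σ.play n) := by
  induction n with
  | zero => exact .init
  | succ n ih => exact ih.step (σ.edge_play n)

theorem isPathFrom_play_shift (n : ℕ) :
    G.IsPathFrom (σ.play n) fun i => σ.play (n + i) :=
  ⟨rfl, fun i => σ.edge_play (n + i)⟩

theorem apply_eq_move {p : P} (h : List V) {v : V} (hv : G.owner v = p) :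
    (σ p h ⟨v, hv⟩).1 = σ.move h v := by
  subst hv
  rfl

theorem move_deviate_of_ne {p : P} (s : G.Strategy p) (h : List V) {v : V}
    (hv : G.owner v ≠ p) : (σ.deviate p s).move h v = σ.move h v := by
  classical
  have : σ.deviate p s (G.owner v) = σ (G.owner v) := Function.update_of_ne hv _ _
  rw [move, move, this]

theorem move_deviate_of_eq {p : P} (s : G.Strategy p) (h : List V) {v : V}
    (hv : G.owner v = p) : (σ.deviate p s).move h v = (s h ⟨v, hv⟩).1 := by
  classical
  have : σ.deviate p s p = s := Function.update_self _ _ _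
  rw [← apply_eq_move _ _ hv, this]

/-- Along a unilateral deviation of `p`, nobody but `p` deviates. -/
theorem dev_deviate_play (p : P) (s : G.Strategy p) (n : ℕ) :
    dev σ (past (σ.deviate p s).play n) ((σ.deviate p s).play n) = none ∨
      dev σ (past (σ.deviate p s).play n) ((σ.deviate p s).play n) = some p := by
  induction n with
  | zero => exact Or.inl rfl
  | succ n ih =>
    rw [past, dev]
    split_ifs with h
    · exact ih
    · refine Or.inr (congrArg some ?_)
      by_contra hne
      rw [play_succ, move_deviate_of_ne _ _ _ hne] at h
      exact h rfl

/-- Here `n` is the last time before the plays first part. Only `p` can have caused the split, and a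
recorded deviator can be replaced but never erased. -/
theorem play_deviate_eq_or (p : P) (s : G.Strategy p) :
    (σ.deviate p s).play = σ.play ∨ ∃ n, (σ.deviate p s).play n = σ.play n ∧
      G.owner (σ.play n) = p ∧
      dev σ (past (σ.deviate p s).play n) ((σ.deviate p s).play n) = none ∧
      ∀ m, n < m →
        dev σ (past (σ.deviate p s).play m) ((σ.deviate p s).play m) = some p := by
  set ρ := (σ.deviate p s).play with hρ
  by_cases h : ∃ n, ρ (n + 1) ≠ σ.play (n + 1)
  · right
    classical
    have hmin (i : ℕ) (hi : i ≤ Nat.find h) : ρ i = σ.play i := by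
      cases i with
      | zero => rfl
      | succ i => exact not_not.1 (Nat.find_min h hi)
    have hspec := Nat.find_spec h
    set n := Nat.find h
    have hpast : past ρ n = past σ.play n := past_congr fun i hi => hmin i hi.le
    have hmove : ρ (n + 1) ≠ σ.move (past ρ n) (ρ n) := by
      rw [hpast, hmin n le_rfl, ← σ.play_succ]
      exact hspec
    have hnone : dev σ (past ρ n) (ρ n) = none := by
      rw [hpast, hmin n le_rfl]
      by_contra hd
      exact ((isDeviating_iff σ (σ.isFinitePlay_play n)).2 (Option.ne_none_iff_exists'.1 hd)).2
        ⟨n, rfl, rfl⟩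
    have hown : G.owner (ρ n) = p := by
      by_contra hne
      refine hmove ?_
      rw [hρ, play_succ, move_deviate_of_ne _ _ _ hne]
    refine ⟨n, hmin n le_rfl, hmin n le_rfl ▸ hown, hnone, fun m hm => ?_⟩
    induction m, hm using Nat.le_induction with
    | base => rw [past, dev, if_neg hmove, hown]
    | succ m hm ih =>
      obtain h0 | h0 := σ.dev_deviate_play p s (m + 1)
      · rw [← hρ, past, dev] at h0
        split_ifs at h0
        rw [ih] at h0
        cases h0
      · exact h0
  · left
    push Not at h
    ext n
    cases n with
    | zero => rfl
    | succ n => exact h n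

end Profile

/-- In an incentive strategy profile, every follower gets at least the value of each vertex
on the play. -/
theorem IsISP.gameValue_le [Finite V] {σ : G.Profile} {γ : G.IncentiveProfile}
    (hISP : IsISP σ γ) (p : G.Follower) {τ : V → V} (hτ : G.IsOptimalMemoryless p.1 τ) (n : ℕ) :
    G.gameValue p.1 (σ.play n) ≤ followerPayoff σ γ p := by
  classical
  -- Obey `σ` until time `n`, which reproduces the play up to its `n`-th vertex, and play optimally
  -- in the zero-sum game from there.
  let s : G.Strategy p.1 := fun h v =>
    if h.length < n then σ p.1 h v else ⟨τ v, hτ.edge v⟩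
  have hmove (m : ℕ) (hm : m < n) (h : List V) (hh : h.length = m) (v : V) :
      (σ.deviate p.1 s).move h v = σ.move h v := by
    by_cases hv : G.owner v = p.1
    · rw [Profile.move_deviate_of_eq _ _ _ hv]
      simp only [s, hh, hm, if_true]
      exact σ.apply_eq_move h hv
    · exact σ.move_deviate_of_ne _ _ hv
  set ρ := (σ.deviate p.1 s).play with hρ
  have hagree (m : ℕ) : m ≤ n → past ρ m = past σ.play m ∧ ρ m = σ.play m := by
    induction m with
    | zero => exact fun _ => ⟨rfl, rfl⟩
    | succ m ih =>
      intro hm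
      obtain ⟨h1, h2⟩ := ih (Nat.le_of_succ_le hm)
      refine ⟨by rw [past, past, h1, h2], ?_⟩
      rw [hρ, Profile.play_succ, ← hρ, h1, h2, hmove m hm _ (length_past _ _), ← σ.play_succ]
  refine le_trans ?_ (hISP p s)
  rw [followerPayoff, ← hρ, ← rawPayoff_shift p.1 ρ n]
  refine le_add_of_le_of_nonneg ?_ (meanPayoff_nonneg fun i => NNReal.coe_nonneg _)
  rw [← (hagree n le_rfl).2]
  refine hτ.maximiser _ _ ((σ.deviate p.1 s).isPathFrom_play_shift n) fun i hi => ?_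
  change ρ (n + i + 1) = _
  rw [hρ, Profile.play_succ, ← hρ, Profile.move_deviate_of_eq _ _ _ hi]
  simp [s, length_past]

/-! ### Perfectly-incentivised profiles for a given play -/

section OfPlay

variable (τ : P → V → V) (π : ℕ → V)

open Classical in
/-- The move at a history on which `o` is the last deviator from the play `π`. -/
def targetMove (o : Option P) (h : List V) (v : V) : V :=
  match o with
  -- The length of the past is the current time. The `else` branch covers histories off the play
  -- with no recorded deviator; any successor would do.
  | none => if v = π h.length then π (h.length + 1) else τ G.leader v
  | some p => τ p v

open Classical in
/-- The last player who deviated from the profile that follows the play `π` and punishes the last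
deviator `p` by `τ p`. -/
def targetDev : List V → V → Option P
  | [], _ => none
  | u :: h, v =>
    if v = targetMove (G := G) τ π (targetDev h u) h u then targetDev h u
    else some (G.owner u)

theorem edge_targetMove (hτ : ∀ p v, G.Edge v (τ p v)) (hπ : ∀ n, G.Edge (π n) (π (n + 1)))
    (o : Option P) (h : List V) (v : V) : G.Edge v (targetMove (G := G) τ π o h v) := by
  cases o with
  | some p => exact hτ p v
  | none =>
    simp only [targetMove]
    split_ifs with hv
    · rw [hv]
      exact hπ _
    · exact hτ _ v

/-- The profile that follows the play `π` and punishes the last deviator `p` by `τ p`. -/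
def profileOfPlay (hτ : ∀ p v, G.Edge v (τ p v)) (hπ : ∀ n, G.Edge (π n) (π (n + 1))) :
    G.Profile :=
  fun _ h v => ⟨targetMove τ π (targetDev (G := G) τ π h v) h v, edge_targetMove τ π hτ hπ _ _ _⟩

variable {τ π} (hτ : ∀ p v, G.Edge v (τ p v)) (hπ : ∀ n, G.Edge (π n) (π (n + 1)))

theorem dev_profileOfPlay (h : List V) (v : V) :
    dev (profileOfPlay τ π hτ hπ) h v = targetDev (G := G) τ π h v := by
  induction h generalizing v with
  | nil => rfl
  | cons u h ih =>
    rw [dev, targetDev, ih]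
    rfl

theorem move_profileOfPlay_of_dev {h : List V} {v : V} {p : P}
    (hd : dev (profileOfPlay τ π hτ hπ) h v = some p) :
    (profileOfPlay τ π hτ hπ).move h v = τ p v := by
  rw [dev_profileOfPlay] at hd
  simp [Profile.move, profileOfPlay, hd, targetMove]

theorem play_profileOfPlay (h0 : π 0 = G.init) : (profileOfPlay τ π hτ hπ).play = π := by
  set σ := profileOfPlay τ π hτ hπ
  ext n
  induction n with
  | zero => exact h0.symm
  | succ n ih =>
    have hd : targetDev (G := G) τ π (past σ.play n) (σ.play n) = none := by
      rw [← dev_profileOfPlay hτ hπ]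
      by_contra hd
      exact ((isDeviating_iff σ (σ.isFinitePlay_play n)).2
        (Option.ne_none_iff_exists'.1 hd)).2 ⟨n, rfl, rfl⟩
    rw [σ.play_succ]
    change targetMove (G := G) τ π (targetDev (G := G) τ π _ _) _ _ = _
    rw [hd]
    simp [targetMove, length_past, ih]

end OfPlay

open Classical in
/-- The incentives that turn `σ` into a perfectly-incentivised profile with the constant incentives
`c` along its play. -/
def perfectIncentives (σ : G.Profile) (c : G.Follower → ℝ≥0) : G.IncentiveProfile :=
  fun q h v =>
    if IsPrefix σ h v then c q
    else if HasColluded σ q h v then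
      match h with
      -- Never reached, since a collusion has a nonempty past. The truncation below is harmless
      -- because rewards on edges are at most `G.rMax`.
      | [] => 0
      | u :: _ => (G.rMax + 1 - G.reward q.1 u v).toNNReal
    else 0

theorem not_isPrefix_of_hasColluded {σ : G.Profile} {q : G.Follower} {h : List V} {v : V}
    (hc : HasColluded σ q h v) : ¬ IsPrefix σ h v := by
  obtain ⟨g, u, p, rfl, hdev, -⟩ := hc
  rintro ⟨n, h1, -⟩
  cases n with
  | zero => simp [past] at h1
  | succ n =>
    rw [past, List.cons.injEq] at h1
    exact hdev.2 ⟨n, h1.2, h1.1⟩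

theorem isPSPFor_perfectIncentives [Finite P] [Finite V] {τ : P → V → V} {σ : G.Profile}
    (hτ : ∀ p, G.IsOptimalMemoryless p (τ p))
    (hσ : ∀ h v p, dev σ h v = some p → σ.move h v = τ p v) (c : G.Follower → ℝ≥0) :
    IsPSPFor τ σ (perfectIncentives σ c) where
  optimal := hτ
  const p h h' v v' h1 h2 := by simp [perfectIncentives, h1, h2]
  punish h v p _ hd := hσ h v p hd
  collude q h u v hc := by
    have hn := not_isPrefix_of_hasColluded hc
    have he : G.Edge u v := by
      obtain ⟨g, u', p, h1, -, -, -, -, rfl⟩ := hc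
      rw [List.cons.injEq] at h1
      rw [h1.1]
      exact σ.edge_move _ _
    have := reward_le_rMax q.1 he
    simp only [perfectIncentives, hn, hc, if_true, if_false]
    rw [Real.coe_toNNReal _ (by linarith)]
    ring
  zero q h v hd hc := by simp [perfectIncentives, hd.2, hc]

theorem payoff_perfectIncentives (σ : G.Profile) (c : G.Follower → ℝ≥0) (p : G.Follower) :
    (perfectIncentives σ c).payoff p σ.play = meanPayoff fun _ => c p := by
  rw [IncentiveProfile.payoff]
  congr 1
  ext i
  have h : IsPrefix σ (past σ.play i) (σ.play i) := ⟨i, rfl, rfl⟩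
  simp [perfectIncentives, h]

/-- A perfectly-incentivised profile in which every follower gets at least the value of each vertex
on the play is an incentive strategy profile. -/
theorem IsPSPFor.isISP [Finite V] {τ : P → V → V} {σ : G.Profile} {γ : G.IncentiveProfile}
    (h : IsPSPFor τ σ γ)
    (hval : ∀ (p : G.Follower) (n : ℕ), G.gameValue p.1 (σ.play n) ≤ followerPayoff σ γ p) :
    IsISP σ γ := by
  intro p s
  obtain heq | ⟨n, hn, hown, hnone, hdev⟩ := σ.play_deviate_eq_or p.1 s
  · rw [followerPayoff, heq]
    rfl
  set ρ := (σ.deviate p.1 s).play with hρ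
  have hdeviating (m : ℕ) (hm : n < m) : IsDeviating σ (past ρ m) (ρ m) :=
    (isDeviating_iff σ ((σ.deviate p.1 s).isFinitePlay_play m)).2 ⟨_, hdev m hm⟩
  -- At time `n + 1` the preceding history is not deviating, and later the deviator is `p` himself,
  -- so `p` never counts as a colluder.
  have hγ : γ.payoff p ρ ≤ 0 := by
    refine meanPayoff_le_zero (n := n + 1) fun m hm => ?_
    rw [h.zero p _ _ (hdeviating m hm), NNReal.coe_zero]
    rintro ⟨g, u, q, h1, -, h2, -, hne, -⟩
    obtain ⟨m, rfl⟩ := Nat.exists_eq_succ_of_ne_zero (Nat.ne_of_gt (Nat.zero_lt_of_lt hm))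
    rw [Nat.succ_eq_add_one, past, List.cons.injEq] at h1
    rw [← h1.1, ← h1.2] at h2
    obtain hm' | hm' := (Nat.le_of_lt_succ hm).eq_or_lt
    · rw [← hm', hnone] at h2
      cases h2
    · rw [hdev m hm', Option.some.injEq] at h2
      exact hne h2
  have hraw : G.rawPayoff p.1 ρ ≤ G.gameValue p.1 (σ.play n) := by
    rw [← rawPayoff_shift p.1 ρ n, ← hn]
    refine (h.optimal p.1).minimiser _ _ ((σ.deviate p.1 s).isPathFrom_play_shift n)
      fun i hi => ?_
    -- At time `n` the vertex belongs to `p`, so the coalition moves only at strictly later times,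
    -- when punishment is already in force.
    have hlt : n < n + i := by
      refine Nat.lt_add_of_pos_right (Nat.pos_of_ne_zero ?_)
      rintro rfl
      exact hi ((congrArg G.owner hn).trans hown)
    change ρ (n + i + 1) = _
    rw [hρ, Profile.play_succ, σ.move_deviate_of_ne s _ hi]
    exact h.punish _ _ _ (hdeviating _ hlt) (hdev _ hlt)
  calc followerPayoff (σ.deviate p.1 s) γ p ≤ G.gameValue p.1 (σ.play n) + 0 := add_le_add hraw hγ
    _ = G.gameValue p.1 (σ.play n) := add_zero _
    _ ≤ _ := hval p n

theorem edgeFreq_eq_average (π : ℕ → V) (u v : V) [DecidableEq V] (n : ℕ) :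
    edgeFreq π u v n = (∑ i ∈ Finset.range n,
      if π i = u ∧ π (i + 1) = v then (1 : ℝ) else 0) / (n : ℝ) := by
  rw [edgeFreq, Finset.sum_boole]
  congr!

end Arena

end

/-! ### The well-behaved profile on the reordered play -/

theorem mainTheorem3 {P V : Type*} [Fintype P] [Fintype V] (G : Arena P V)
    (σ : G.Profile) (γ : G.IncentiveProfile)
    (hPSP : Arena.IsPSP σ γ) (hISP : Arena.IsISP σ γ) :
    ∃ (σ' : G.Profile) (γ' : G.IncentiveProfile),
      Arena.IsPSP σ' γ' ∧ Arena.IsISP σ' γ' ∧ Arena.IsWellBehaved σ' ∧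
        Arena.leaderPayoff σ γ ≤ Arena.leaderPayoff σ' γ' := by
  classical
  obtain ⟨τ, hτ⟩ := hPSP
  -- The averaged functions are the edge indicators, for good behaviour, and the rewards of all
  -- players, for the payoffs.
  obtain ⟨t, ht0, ht, hφ⟩ := exists_reordering_averages_tendsto (ι := (V × V) ⊕ P) σ.play
    (Sum.elim (fun e u v => if u = e.1 ∧ v = e.2 then 1 else 0) fun p u v => G.reward p u v)
  set π : ℕ → V := fun n => σ.play (t n)
  have hedge (n : ℕ) : G.Edge (π n) (π (n + 1)) := by
    simp only [π, ht]
    exact σ.edge_play _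
  have hinit : π 0 = G.init := by simp only [π, ht0]; rfl
  set σ' := Arena.profileOfPlay τ π (fun p => (hτ.optimal p).edge) hedge
  have hplay : σ'.play = π := Arena.play_profileOfPlay _ _ hinit
  set γ' := Arena.perfectIncentives σ' fun p => γ p [] G.init
  have hPSP' : Arena.IsPSPFor τ σ' γ' := Arena.isPSPFor_perfectIncentives hτ.optimal
    (fun h v p => Arena.move_profileOfPlay_of_dev _ _) _
  have hraw (p : P) : G.rawPayoff p σ.play ≤ G.rawPayoff p σ'.play := by
    obtain ⟨c, hc, hlim⟩ := hφ (Sum.inr p)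
    rw [hplay, Arena.rawPayoff, Arena.rawPayoff]
    exact hc.trans_eq (meanPayoff_eq_of_tendsto hlim).symm
  have hinc (p : G.Follower) : γ'.payoff p σ'.play = γ.payoff p σ.play := by
    rw [Arena.payoff_perfectIncentives, Arena.IncentiveProfile.payoff]
    congr 1
    ext i
    rw [hτ.const p [] (past σ.play i) G.init (σ.play i) ⟨0, rfl, rfl⟩ ⟨i, rfl, rfl⟩]
  refine ⟨σ', γ', ⟨τ, hPSP'⟩, hPSP'.isISP fun p n => ?_, fun u v _ => ?_, ?_⟩
  · rw [hplay]
    -- The `n`-th vertex of the new play is vertex `t n` of the old one, so the old bound on its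
    -- value applies.
    refine (hISP.gameValue_le p (hτ.optimal p.1) (t n)).trans ?_
    rw [Arena.followerPayoff, Arena.followerPayoff, hinc]
    exact add_le_add_left (hraw p.1) _
  · obtain ⟨c, -, hlim⟩ := hφ (Sum.inl (u, v))
    refine ⟨c, hlim.congr fun n => ?_⟩
    rw [hplay, Arena.edgeFreq_eq_average]
    rfl
  · simp only [Arena.leaderPayoff, hinc]
    exact EReal.sub_le_sub (hraw _) le_rfl
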